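/- Let $\Gamma$ be a torsion-free discrete subgroup of $PSL(2,\mathbb{R})$, let $S=\Gamma\backslash\mathbb{H}$ be the corresponding hyperbolic surface and let $T^1S=\Gamma\backslash PSL(2,\mathbb{R})$ be its unit tangent bundle, with base point projection $\pi:T^1S\to S$, $\pi(\Gamma g)=\Gamma\, g(i)$. The geodesic flow $g_t$ and the horocycle flow $h_s$ on $T^1S$ are given by right multiplication by $$\begin{pmatrix} e^{t/2} & 0\\ 0 & e^{-t/2}\end{pmatrix}\quad\text{and}\quad \begin{pmatrix} 1 & s\\ 0 & 1\end{pmatrix}$$ respectively, and $h_{\mathbb{R}}(u)=\{h_s(u): s\in\mathbb{R}\}$. A closed geodesic $\alpha$ of length $\ell(\alpha)=\ell>0$ in $S$ is the projection $\{\pi(g_t(v)):t\in\mathbb{R}\}$ of a periodic orbit of the geodesic flow, $g_{\ell}(v)=v$. Let $u\in T^1S$ and let $b\ge a>0$. Suppose that there are a sequence $(\alpha_n)$ of closed geodesics in $S$ of lengths $\ell(\alpha_n)\in[a,b]$ and a sequence of times $t_n\to+\infty$ such that $\pi(g_{t_n}(u))\in\alpha_n$ for all $n$. Then there exists $t_0>0$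 such that $$g_{t_0}(u)\in\overline{h_{\mathbb{R}}(u)}.$$ -/

import Mathlib

open scoped MatrixGroups UpperHalfPlane

noncomputable section

namespace HyperbolicSurface

/-- The centre `{1, -1}` of `SL(2, ℝ)` acts trivially on the upper half-plane. -/
theorem center_smul (g : SL(2, ℝ)) (hg : g ∈ Subgroup.center SL(2, ℝ)) (z : ℍ) : g • z = z := by
  obtain ⟨r, hr, hrg⟩ := Matrix.SpecialLinearGroup.mem_center_iff.mp hg
  have hr0 : (r : ℂ) ≠ 0 := by
    rintro h
    have : r = 0 := by exact_mod_cast h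
    subst this
    simp at hr
  have h00 : g 0 0 = r := by rw [← hrg]; simp
  have h01 : g 0 1 = 0 := by rw [← hrg]; simp
  have h10 : g 1 0 = 0 := by rw [← hrg]; simp
  have h11 : g 1 1 = r := by rw [← hrg]; simp
  apply UpperHalfPlane.ext
  rw [UpperHalfPlane.coe_specialLinearGroup_apply, h00, h01, h10, h11]
  simp only [Algebra.algebraMap_self, RingHom.id_apply, Complex.ofReal_zero, zero_mul, zero_add,
    add_zero]
  field_simp

/-- The action of `PSL(2, ℝ)` on the upper half-plane by Möbius transformations. -/
instance pslAction : MulAction PSL(2, ℝ) ℍ :=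
  MulAction.compHom ℍ (QuotientGroup.lift (Subgroup.center SL(2, ℝ))
    (MulAction.toPermHom SL(2, ℝ) ℍ)
    (fun g hg => Equiv.ext fun z => center_smul g hg z))

theorem mk_smul (g : SL(2, ℝ)) (z : ℍ) : (QuotientGroup.mk g : PSL(2, ℝ)) • z = g • z := rfl

/-- `Γ ≤ PSL(2, ℝ)` is discrete and torsion-free, so that `Γ \ ℍ` is a hyperbolic surface. -/
structure IsSurfaceGroup (Γ : Subgroup PSL(2, ℝ)) : Prop where
  discrete : DiscreteTopology Γ
  torsionFree : ∀ γ ∈ Γ, IsOfFinOrder γ → γ = 1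

/-- The hyperbolic surface `S = Γ \ ℍ`. -/
abbrev Surface (Γ : Subgroup PSL(2, ℝ)) : Type := Quotient (MulAction.orbitRel Γ ℍ)

/-- The unit tangent bundle `T¹S = Γ \ PSL(2, ℝ)` of `S = Γ \ ℍ`, with the quotient topology. The
class of `g` stands for the image under `g` of the upward unit vector at `i`. -/
abbrev UnitTangent (Γ : Subgroup PSL(2, ℝ)) : Type := Quotient (MulAction.orbitRel Γ PSL(2, ℝ))

/-- Right multiplication by `x ∈ PSL(2, ℝ)` on `T¹S = Γ \ PSL(2, ℝ)`. -/
def rightMul {Γ : Subgroup PSL(2, ℝ)} (x : PSL(2, ℝ)) : UnitTangent Γ → UnitTangent Γ :=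
  Quotient.map (fun g => g * x) (by
    rintro _ g ⟨γ, rfl⟩
    exact ⟨γ, (mul_assoc (γ : PSL(2, ℝ)) g x).symm⟩)

/-- The diagonal matrix with entries `e^{t/2}` and `e^{-t/2}`. -/
def diagMatrix (t : ℝ) : SL(2, ℝ) :=
  ⟨!![Real.exp (t / 2), 0; 0, Real.exp (-t / 2)], by
    rw [Matrix.det_fin_two_of, ← Real.exp_add]; ring_nf; simp⟩

/-- The upper triangular unipotent matrix with upper right entry `s`. -/
def unipMatrix (s : ℝ) : SL(2, ℝ) :=
  ⟨!![1, s; 0, 1], by simp [Matrix.det_fin_two_of]⟩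

/-- The geodesic flow `g_t` on `T¹S`. -/
def geodesicFlow {Γ : Subgroup PSL(2, ℝ)} (t : ℝ) : UnitTangent Γ → UnitTangent Γ :=
  rightMul (QuotientGroup.mk (diagMatrix t))

/-- The horocycle flow `h_s` on `T¹S`. -/
def horocycleFlow {Γ : Subgroup PSL(2, ℝ)} (s : ℝ) : UnitTangent Γ → UnitTangent Γ :=
  rightMul (QuotientGroup.mk (unipMatrix s))

/-- The orbit `h_ℝ(u)` of `u` under the horocycle flow. -/
def horocycleOrbit {Γ : Subgroup PSL(2, ℝ)} (u : UnitTangent Γ) : Set (UnitTangent Γ) :=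
  Set.range fun s : ℝ => horocycleFlow s u

/-- The projection `π : T¹S → S` to the base point, induced by `g ↦ g • i`. -/
def basePoint {Γ : Subgroup PSL(2, ℝ)} : UnitTangent Γ → Surface Γ :=
  Quotient.map (fun g : PSL(2, ℝ) => g • UpperHalfPlane.I) (by
    rintro _ g ⟨γ, rfl⟩
    exact ⟨γ, (mul_smul (γ : PSL(2, ℝ)) g UpperHalfPlane.I).symm⟩)

/-- A closed geodesic of `S = Γ \ ℍ`: the unit speed geodesic with initial vector `initial`
followed for the time `length > 0`, at which it returns to its initial vector. The same closed
curve run through several times is allowed, with the length counted accordingly. -/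
structure ClosedGeodesic (Γ : Subgroup PSL(2, ℝ)) where
  initial : UnitTangent Γ
  length : ℝ
  length_pos : 0 < length
  closes : geodesicFlow length initial = initial

/-- The set of points of `S` on a closed geodesic. -/
def ClosedGeodesic.support {Γ : Subgroup PSL(2, ℝ)} (α : ClosedGeodesic Γ) : Set (Surface Γ) :=
  Set.range fun t : ℝ => basePoint (geodesicFlow t α.initial)

end HyperbolicSurface

end

/-!
Write `a_t`, `n_s` for the matrices defining `g_t`, `h_s`, and `n⁻_x` for the transpose of `n_x`. If
`w = g_t u` has its base point on a closed geodesic of length `ℓ`, then rotating `w` by some `k`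
fixing `i` gives a vector fixed by `g_ℓ`, so `w` is fixed by right multiplication by
`h = k a_ℓ k⁻¹`. This `h` is symmetric with trace `2 cosh (ℓ / 2)`; after replacing it by its
inverse, which runs the closed geodesic backwards, its upper left entry is at least
`cosh (ℓ / 2) > 1`. Hence `h = n⁻_x a_τ n_y` with `|x| ≤ 1` and `0 < 2 log cosh (ℓ / 2) ≤ τ ≤ ℓ`.
Conjugating `h` by `a_t` replaces `x` by `e⁻ᵗ x`, so `g_τ (u n⁻_{e⁻ᵗ x})` lies on the horocycle
orbit of `u`. As `t → ∞` the perturbation dies out, while `τ` stays in a compact subset of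
`(0, ∞)`.
-/

noncomputable section

namespace HyperbolicSurface

theorem log_cosh_le_log_cosh {x y : ℝ} (hx : 0 ≤ x) (hxy : x ≤ y) :
    Real.log (Real.cosh x) ≤ Real.log (Real.cosh y) := by
  refine Real.log_le_log (Real.cosh_pos x) (Real.cosh_le_cosh.mpr ?_)
  rwa [abs_of_nonneg hx, abs_of_nonneg (hx.trans hxy)]

section Matrices

open Matrix Matrix.SpecialLinearGroup

theorem coe_diagMatrix (t : ℝ) :
    (diagMatrix t : Matrix (Fin 2) (Fin 2) ℝ) = !![Real.exp (t / 2), 0; 0, Real.exp (-t / 2)] :=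
  rfl

theorem coe_unipMatrix (s : ℝ) : (unipMatrix s : Matrix (Fin 2) (Fin 2) ℝ) = !![1, s; 0, 1] :=
  rfl

theorem coe_transpose_unipMatrix (s : ℝ) :
    ((unipMatrix s).transpose : Matrix (Fin 2) (Fin 2) ℝ) = !![1, 0; s, 1] := by
  rw [coe_transpose, coe_unipMatrix, eta_fin_two !![1, s; 0, 1]ᵀ]
  simp

theorem diagMatrix_zero : diagMatrix 0 = 1 :=
  Subtype.ext <| by simp [coe_diagMatrix, one_fin_two]

theorem diagMatrix_add (s t : ℝ) : diagMatrix (s + t) = diagMatrix s * diagMatrix t :=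
  Subtype.ext <| by simp [coe_diagMatrix, ← Real.exp_add, add_div, add_comm]

theorem continuous_diagMatrix : Continuous diagMatrix := by
  have hexp : Continuous fun t : ℝ => Real.exp (t / 2) := by fun_prop
  have hexp_neg : Continuous fun t : ℝ => Real.exp (-t / 2) := by fun_prop
  refine Continuous.subtype_mk (continuous_matrix ?_) _
  simpa [Fin.forall_fin_two, continuous_const] using ⟨hexp, hexp_neg⟩

theorem isSymm_diagMatrix (t : ℝ) : (diagMatrix t : Matrix (Fin 2) (Fin 2) ℝ).IsSymm :=
  IsSymm.ext <| by simp [Fin.forall_fin_two, coe_diagMatrix]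

theorem trace_diagMatrix (t : ℝ) :
    (diagMatrix t : Matrix (Fin 2) (Fin 2) ℝ).trace = 2 * Real.cosh (t / 2) := by
  rw [coe_diagMatrix, trace_fin_two_of, Real.cosh_eq, neg_div]
  ring

theorem unipMatrix_zero : unipMatrix 0 = 1 :=
  Subtype.ext <| by simp [coe_unipMatrix, one_fin_two]

theorem unipMatrix_add (s t : ℝ) : unipMatrix (s + t) = unipMatrix s * unipMatrix t :=
  Subtype.ext <| by simp [coe_unipMatrix, add_comm]

theorem continuous_transpose_unipMatrix :
    Continuous fun s : ℝ => (unipMatrix s).transpose := by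
  refine Continuous.subtype_mk (continuous_matrix ?_) _
  simp [Fin.forall_fin_two, unipMatrix, continuous_const, continuous_id']

theorem unipMatrix_mul_diagMatrix (s t : ℝ) :
    unipMatrix s * diagMatrix t = diagMatrix t * unipMatrix (Real.exp (-t) * s) := by
  have hexp : Real.exp (-t / 2) = Real.exp (t / 2) * Real.exp (-t) := by
    rw [← Real.exp_add]; ring_nf
  exact Subtype.ext <| by simp [coe_unipMatrix, coe_diagMatrix, hexp, mul_comm s, mul_assoc]

theorem transpose_unipMatrix_mul_diagMatrix (s t : ℝ) :
    (unipMatrix s).transpose * diagMatrix t =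
      diagMatrix t * (unipMatrix (Real.exp t * s)).transpose := by
  have hexp : Real.exp (t / 2) = Real.exp (-t / 2) * Real.exp t := by
    rw [← Real.exp_add]; ring_nf
  exact Subtype.ext <| by
    simp [coe_transpose_unipMatrix, coe_diagMatrix, hexp, mul_comm s, mul_assoc, -coe_transpose]

theorem eq_transpose_unipMatrix_mul_diagMatrix_mul_unipMatrix {h : SL(2, ℝ)} (h00 : 0 < h 0 0) :
    h = (unipMatrix (h 1 0 / h 0 0)).transpose * diagMatrix (2 * Real.log (h 0 0)) *
      unipMatrix (h 0 1 / h 0 0) := by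
  have hdet : h 0 0 * h 1 1 - h 0 1 * h 1 0 = 1 := by rw [← det_fin_two, h.det_coe]
  have hexp : Real.exp (2 * Real.log (h 0 0) / 2) = h 0 0 := by
    rw [mul_div_cancel_left₀ _ two_ne_zero, Real.exp_log h00]
  have hexp_neg : Real.exp (-(2 * Real.log (h 0 0)) / 2) = (h 0 0)⁻¹ := by
    rw [neg_div, Real.exp_neg, hexp]
  have h11 : h 1 1 = h 1 0 * (h 0 1 / h 0 0) + (h 0 0)⁻¹ := by
    field_simp
    linarith
  apply Subtype.ext
  rw [coe_mul, coe_mul, coe_transpose_unipMatrix, coe_diagMatrix, coe_unipMatrix, hexp, hexp_neg,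
    mul_fin_two, mul_fin_two, eta_fin_two (h : Matrix (Fin 2) (Fin 2) ℝ), h11]
  simp [h00.ne', mul_div_cancel₀]

theorem coe_inv_eq_transpose_of_smul_I {k : SL(2, ℝ)}
    (hk : k • UpperHalfPlane.I = UpperHalfPlane.I) :
    ((k⁻¹ : SL(2, ℝ)) : Matrix (Fin 2) (Fin 2) ℝ) = (k : Matrix (Fin 2) (Fin 2) ℝ)ᵀ := by
  have hcoe := congrArg UpperHalfPlane.coe hk
  have hden := UpperHalfPlane.denom_ne_zero (k : GL (Fin 2) ℝ) UpperHalfPlane.I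
  rw [UpperHalfPlane.coe_specialLinearGroup_apply, div_eq_iff (by exact hden)] at hcoe
  have hre : k 0 1 = -k 1 0 := by simpa using congrArg Complex.re hcoe
  have him : k 0 0 = k 1 1 := by simpa using congrArg Complex.im hcoe
  rw [coe_inv, adjugate_fin_two, eta_fin_two (k : Matrix (Fin 2) (Fin 2) ℝ)ᵀ]
  simp [hre, him]

theorem isSymm_conj_of_smul_I {k h : SL(2, ℝ)} (hk : k • UpperHalfPlane.I = UpperHalfPlane.I)
    (hh : (h : Matrix (Fin 2) (Fin 2) ℝ).IsSymm) :
    ((k * h * k⁻¹ : SL(2, ℝ)) : Matrix (Fin 2) (Fin 2) ℝ).IsSymm := by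
  rw [IsSymm, coe_mul, coe_mul, coe_inv_eq_transpose_of_smul_I hk]
  simp only [transpose_mul, transpose_transpose, hh.eq, Matrix.mul_assoc]

theorem trace_conj {n R : Type*} [Fintype n] [DecidableEq n] [CommRing R]
    (k h : SpecialLinearGroup n R) :
    ((k * h * k⁻¹ : SpecialLinearGroup n R) : Matrix n n R).trace = (h : Matrix n n R).trace := by
  rw [coe_mul, trace_mul_comm, ← coe_mul, inv_mul_cancel_left]

theorem isSymm_inv {n R : Type*} [Fintype n] [DecidableEq n] [CommRing R]
    {h : SpecialLinearGroup n R} (hh : (h : Matrix n n R).IsSymm) :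
    ((h⁻¹ : SpecialLinearGroup n R) : Matrix n n R).IsSymm := by
  rw [coe_inv]
  exact hh.adjugate

theorem trace_inv {R : Type*} [CommRing R] (h : SL(2, R)) :
    ((h⁻¹ : SL(2, R)) : Matrix (Fin 2) (Fin 2) R).trace =
      (h : Matrix (Fin 2) (Fin 2) R).trace := by
  rw [coe_inv, adjugate_fin_two, trace_fin_two_of, trace_fin_two, add_comm]

theorem apply_mul_apply_eq_one_add_sq_of_isSymm {R : Type*} [CommRing R] {h : SL(2, R)}
    (hh : (h : Matrix (Fin 2) (Fin 2) R).IsSymm) : h 0 0 * h 1 1 = 1 + h 1 0 ^ 2 := by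
  have hdet : h 0 0 * h 1 1 - h 0 1 * h 1 0 = 1 := by rw [← det_fin_two, h.det_coe]
  rw [show h 0 1 = h 1 0 from hh.apply 1 0] at hdet
  linear_combination hdet

theorem apply_zero_zero_le_exp_of_isSymm {h : SL(2, ℝ)}
    (hh : (h : Matrix (Fin 2) (Fin 2) ℝ).IsSymm) {x : ℝ} (hx : 0 ≤ x)
    (htr : (h : Matrix (Fin 2) (Fin 2) ℝ).trace = 2 * Real.cosh x) : h 0 0 ≤ Real.exp x := by
  have hdet := apply_mul_apply_eq_one_add_sq_of_isSymm hh
  have hexp : Real.exp x * Real.exp (-x) = 1 := by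
    rw [← Real.exp_add, add_neg_cancel, Real.exp_zero]
  have hle : Real.exp (-x) ≤ Real.exp x := Real.exp_le_exp.mpr (by linarith)
  rw [trace_fin_two, Real.cosh_eq] at htr
  -- The left side is the characteristic polynomial of `h` at `h 0 0`.
  have hchar : (h 0 0 - Real.exp x) * (h 0 0 - Real.exp (-x)) = -h 1 0 ^ 2 := by
    linear_combination hexp - hdet + h 0 0 * htr
  by_contra! hlt
  nlinarith [mul_pos (sub_pos.mpr hlt) (sub_pos.mpr (hle.trans_lt hlt)), sq_nonneg (h 1 0)]

theorem abs_div_le_one_of_isSymm {K : Type*} [Field K] [LinearOrder K] [IsStrictOrderedRing K]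
    {h : SL(2, K)} (hh : (h : Matrix (Fin 2) (Fin 2) K).IsSymm)
    (h00 : 0 ≤ h 0 0) (hle : h 1 1 ≤ h 0 0) : |h 1 0 / h 0 0| ≤ 1 := by
  have hdet := apply_mul_apply_eq_one_add_sq_of_isSymm hh
  have hoff : |h 1 0| ≤ h 0 0 := abs_le_of_sq_le_sq (by nlinarith) h00
  rw [abs_div, abs_of_nonneg h00]
  exact div_le_one_of_le₀ hoff h00

end Matrices

section RightMul

variable {Γ : Subgroup PSL(2, ℝ)}

theorem rightMul_one (u : UnitTangent Γ) : rightMul 1 u = u := by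
  induction u using Quotient.inductionOn with
  | h g => exact congrArg _ (mul_one g)

theorem rightMul_mul (x y : PSL(2, ℝ)) (u : UnitTangent Γ) :
    rightMul (x * y) u = rightMul y (rightMul x u) := by
  induction u using Quotient.inductionOn with
  | h g => exact congrArg _ (mul_assoc g x y).symm

theorem rightMul_inv_eq_self {x : PSL(2, ℝ)} {u : UnitTangent Γ} (hu : rightMul x u = u) :
    rightMul x⁻¹ u = u := by
  conv_lhs => rw [← hu]
  rw [← rightMul_mul, mul_inv_cancel, rightMul_one]

theorem rightMul_conj_eq_self {k x : PSL(2, ℝ)} {u : UnitTangent Γ}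
    (hu : rightMul x (rightMul k u) = rightMul k u) : rightMul (k * x * k⁻¹) u = u := by
  rw [rightMul_mul, rightMul_mul, hu, ← rightMul_mul, mul_inv_cancel, rightMul_one]

theorem continuous_rightMul (u : UnitTangent Γ) :
    Continuous fun x : PSL(2, ℝ) => rightMul x u := by
  induction u using Quotient.inductionOn with
  | h g => exact continuous_quotient_mk'.comp (continuous_const_mul g)

theorem exists_eq_rightMul_of_basePoint_eq {v w : UnitTangent Γ} (h : basePoint v = basePoint w) :
    ∃ k : SL(2, ℝ), k • UpperHalfPlane.I = UpperHalfPlane.I ∧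
      v = rightMul (k : PSL(2, ℝ)) w := by
  induction v using Quotient.inductionOn with | h x => ?_
  induction w using Quotient.inductionOn with | h y => ?_
  obtain ⟨γ, hγ⟩ := Quotient.exact h
  obtain ⟨k, hk⟩ := QuotientGroup.mk_surjective (y⁻¹ * ((γ : PSL(2, ℝ))⁻¹ * x))
  have hfix : (k : PSL(2, ℝ)) • UpperHalfPlane.I = UpperHalfPlane.I := by
    have hγ' : (γ : PSL(2, ℝ)) • y • UpperHalfPlane.I = x • UpperHalfPlane.I := hγ
    rw [hk, mul_smul, mul_smul, ← hγ', inv_smul_smul, inv_smul_smul]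
  refine ⟨k, hfix, Quotient.sound ⟨γ, ?_⟩⟩
  change (γ : PSL(2, ℝ)) * (y * (k : PSL(2, ℝ))) = x
  rw [hk]
  group

end RightMul

section Flows

variable {Γ : Subgroup PSL(2, ℝ)}

/-- The opposite horocycle flow, given by right multiplication by lower triangular unipotent
matrices. The geodesic flow in positive time contracts the horocycle flow and expands this one. -/
def oppositeHorocycleFlow (s : ℝ) : UnitTangent Γ → UnitTangent Γ :=
  rightMul (QuotientGroup.mk (unipMatrix s).transpose)

theorem geodesicFlow_zero (u : UnitTangent Γ) : geodesicFlow 0 u = u := by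
  rw [geodesicFlow, diagMatrix_zero, QuotientGroup.mk_one, rightMul_one]

theorem geodesicFlow_add (s t : ℝ) (u : UnitTangent Γ) :
    geodesicFlow (s + t) u = geodesicFlow t (geodesicFlow s u) := by
  simp only [geodesicFlow, diagMatrix_add, QuotientGroup.mk_mul, rightMul_mul]

theorem geodesicFlow_comm (s t : ℝ) (u : UnitTangent Γ) :
    geodesicFlow s (geodesicFlow t u) = geodesicFlow t (geodesicFlow s u) := by
  rw [← geodesicFlow_add, add_comm, geodesicFlow_add]

theorem horocycleFlow_zero (u : UnitTangent Γ) : horocycleFlow 0 u = u := by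
  rw [horocycleFlow, unipMatrix_zero, QuotientGroup.mk_one, rightMul_one]

theorem horocycleFlow_add (s t : ℝ) (u : UnitTangent Γ) :
    horocycleFlow (s + t) u = horocycleFlow t (horocycleFlow s u) := by
  simp only [horocycleFlow, unipMatrix_add, QuotientGroup.mk_mul, rightMul_mul]

theorem oppositeHorocycleFlow_zero (u : UnitTangent Γ) : oppositeHorocycleFlow 0 u = u := by
  have hone : (unipMatrix 0).transpose = 1 := by
    rw [unipMatrix_zero]
    exact Subtype.ext Matrix.transpose_one
  rw [oppositeHorocycleFlow, hone, QuotientGroup.mk_one, rightMul_one]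

theorem geodesicFlow_horocycleFlow (s t : ℝ) (u : UnitTangent Γ) :
    geodesicFlow t (horocycleFlow s u) =
      horocycleFlow (Real.exp (-t) * s) (geodesicFlow t u) := by
  simp only [geodesicFlow, horocycleFlow, ← rightMul_mul, ← QuotientGroup.mk_mul,
    unipMatrix_mul_diagMatrix]

theorem geodesicFlow_oppositeHorocycleFlow (s t : ℝ) (u : UnitTangent Γ) :
    geodesicFlow t (oppositeHorocycleFlow s u) =
      oppositeHorocycleFlow (Real.exp t * s) (geodesicFlow t u) := by
  simp only [geodesicFlow, oppositeHorocycleFlow, ← rightMul_mul, ← QuotientGroup.mk_mul,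
    transpose_unipMatrix_mul_diagMatrix]

theorem continuous_geodesicFlow_oppositeHorocycleFlow (u : UnitTangent Γ) :
    Continuous fun x : ℝ × ℝ => geodesicFlow x.1 (oppositeHorocycleFlow x.2 u) := by
  have hmul : Continuous fun x : ℝ × ℝ => (unipMatrix x.2).transpose * diagMatrix x.1 :=
    (continuous_transpose_unipMatrix.comp continuous_snd).mul
      (continuous_diagMatrix.comp continuous_fst)
  simp only [geodesicFlow, oppositeHorocycleFlow, ← rightMul_mul, ← QuotientGroup.mk_mul]
  exact (continuous_rightMul u).comp (QuotientGroup.continuous_mk.comp hmul)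

theorem rightMul_eq_horocycleFlow_geodesicFlow {h : SL(2, ℝ)} (h00 : 0 < h 0 0)
    (u : UnitTangent Γ) :
    rightMul (h : PSL(2, ℝ)) u = horocycleFlow (h 0 1 / h 0 0)
      (geodesicFlow (2 * Real.log (h 0 0)) (oppositeHorocycleFlow (h 1 0 / h 0 0) u)) := by
  conv_lhs => rw [eq_transpose_unipMatrix_mul_diagMatrix_mul_unipMatrix h00]
  simp only [QuotientGroup.mk_mul, rightMul_mul, horocycleFlow, geodesicFlow,
    oppositeHorocycleFlow]

theorem mem_horocycleOrbit_of_horocycleFlow_eq {s : ℝ} {u v : UnitTangent Γ}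
    (h : horocycleFlow s v = u) : v ∈ horocycleOrbit u :=
  ⟨-s, by simp only [← h, ← horocycleFlow_add, add_neg_cancel, horocycleFlow_zero]⟩

theorem geodesicFlow_oppositeHorocycleFlow_mem_horocycleOrbit {t x y τ : ℝ} {u : UnitTangent Γ}
    (h : horocycleFlow y (geodesicFlow τ (oppositeHorocycleFlow x (geodesicFlow t u))) =
      geodesicFlow t u) :
    geodesicFlow τ (oppositeHorocycleFlow (Real.exp (-t) * x) u) ∈ horocycleOrbit u := by
  have hcancel : geodesicFlow (-t) (geodesicFlow t u) = u := by
    rw [← geodesicFlow_add, add_neg_cancel, geodesicFlow_zero]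
  refine mem_horocycleOrbit_of_horocycleFlow_eq (s := Real.exp (- -t) * y) ?_
  calc horocycleFlow (Real.exp (- -t) * y)
        (geodesicFlow τ (oppositeHorocycleFlow (Real.exp (-t) * x) u))
      = geodesicFlow (-t) (horocycleFlow y
          (geodesicFlow τ (oppositeHorocycleFlow x (geodesicFlow t u)))) := by
        rw [geodesicFlow_horocycleFlow, geodesicFlow_comm (-t) τ,
          geodesicFlow_oppositeHorocycleFlow x, hcancel]
    _ = u := by rw [h, hcancel]

end Flows

section ClosedGeodesics

variable {Γ : Subgroup PSL(2, ℝ)}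

theorem ClosedGeodesic.exists_geodesicFlow_length_eq_self (α : ClosedGeodesic Γ) {p : Surface Γ}
    (hp : p ∈ α.support) :
    ∃ v : UnitTangent Γ, geodesicFlow α.length v = v ∧ basePoint v = p := by
  obtain ⟨s, hs⟩ := hp
  exact ⟨geodesicFlow s α.initial, by rw [geodesicFlow_comm, α.closes], hs⟩

theorem ClosedGeodesic.exists_isSymm_rightMul_eq_self (α : ClosedGeodesic Γ) {w : UnitTangent Γ}
    (hw : basePoint w ∈ α.support) :
    ∃ h : SL(2, ℝ), (h : Matrix (Fin 2) (Fin 2) ℝ).IsSymm ∧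
      (h : Matrix (Fin 2) (Fin 2) ℝ).trace = 2 * Real.cosh (α.length / 2) ∧
      h 1 1 ≤ h 0 0 ∧ rightMul (h : PSL(2, ℝ)) w = w := by
  obtain ⟨v, hv, hvw⟩ := α.exists_geodesicFlow_length_eq_self hw
  obtain ⟨k, hk, rfl⟩ := exists_eq_rightMul_of_basePoint_eq hvw
  have hfix := rightMul_conj_eq_self hv
  set h : SL(2, ℝ) := k * diagMatrix α.length * k⁻¹
  have hsymm : (h : Matrix (Fin 2) (Fin 2) ℝ).IsSymm :=
    isSymm_conj_of_smul_I hk (isSymm_diagMatrix _)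
  have htrace : (h : Matrix (Fin 2) (Fin 2) ℝ).trace = 2 * Real.cosh (α.length / 2) := by
    rw [trace_conj, trace_diagMatrix]
  -- The inverse runs the closed geodesic backwards and exchanges the diagonal entries.
  rcases le_total (h 1 1) (h 0 0) with hle | hle
  · exact ⟨h, hsymm, htrace, hle, hfix⟩
  · refine ⟨h⁻¹, isSymm_inv hsymm, by rw [trace_inv, htrace], ?_, rightMul_inv_eq_self hfix⟩
    simpa [Matrix.SpecialLinearGroup.SL2_inv_expl] using hle

theorem ClosedGeodesic.exists_geodesicFlow_oppositeHorocycleFlow_mem_horocycleOrbit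
    (α : ClosedGeodesic Γ) {u : UnitTangent Γ} {t : ℝ}
    (hmeet : basePoint (geodesicFlow t u) ∈ α.support) :
    ∃ τ ∈ Set.Icc (2 * Real.log (Real.cosh (α.length / 2))) α.length, ∃ x : ℝ, |x| ≤ 1 ∧
      geodesicFlow τ (oppositeHorocycleFlow (Real.exp (-t) * x) u) ∈ horocycleOrbit u := by
  obtain ⟨h, hsymm, htrace, hle, hfix⟩ := α.exists_isSymm_rightMul_eq_self hmeet
  have hcosh : Real.cosh (α.length / 2) ≤ h 0 0 := by
    rw [Matrix.trace_fin_two] at htrace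
    linarith
  have h00 : 0 < h 0 0 := (Real.cosh_pos _).trans_le hcosh
  have hexp : h 0 0 ≤ Real.exp (α.length / 2) :=
    apply_zero_zero_le_exp_of_isSymm hsymm (half_pos α.length_pos).le htrace
  have hlog_lower := Real.log_le_log (Real.cosh_pos _) hcosh
  have hlog_upper := (Real.log_le_iff_le_exp h00).mpr hexp
  rw [rightMul_eq_horocycleFlow_geodesicFlow h00] at hfix
  exact ⟨2 * Real.log (h 0 0), ⟨by linarith, by linarith⟩, h 1 0 / h 0 0,
    abs_div_le_one_of_isSymm hsymm h00.le hle,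
    geodesicFlow_oppositeHorocycleFlow_mem_horocycleOrbit hfix⟩

end ClosedGeodesics

end HyperbolicSurface

end

open HyperbolicSurface Filter Topology in
theorem mainTheorem4_general (Γ : Subgroup PSL(2, ℝ)) (u : UnitTangent Γ) (a b : ℝ) (ha : 0 < a)
    (α : ℕ → ClosedGeodesic Γ) (hα : ∀ n, (α n).length ∈ Set.Icc a b)
    (t : ℕ → ℝ) (ht : Tendsto t atTop atTop)
    (hmeet : ∀ n, basePoint (geodesicFlow (t n) u) ∈ (α n).support) :
    ∃ t₀ : ℝ, 0 < t₀ ∧ geodesicFlow t₀ u ∈ closure (horocycleOrbit u) := by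
  choose τ hτ x hx hmem using fun n =>
    (α n).exists_geodesicFlow_oppositeHorocycleFlow_mem_horocycleOrbit (hmeet n)
  have hlog (n : ℕ) := log_cosh_le_log_cosh (half_pos ha).le
    (div_le_div_of_nonneg_right (hα n).1 zero_le_two)
  have hτ_mem : ∀ n, τ n ∈ Set.Icc (2 * Real.log (Real.cosh (a / 2))) b := fun n =>
    ⟨by linarith [(hτ n).1, hlog n], (hτ n).2.trans (hα n).2⟩
  obtain ⟨t₀, ht₀, φ, hφ, hlim⟩ := isCompact_Icc.tendsto_subseq hτ_mem
  have hpos : 0 < Real.log (Real.cosh (a / 2)) :=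
    Real.log_pos (Real.one_lt_cosh.mpr (half_pos ha).ne')
  have hvanish : Tendsto (fun n => Real.exp (-t n) * x n) atTop (𝓝 0) :=
    (Real.tendsto_exp_neg_atTop_nhds_zero.comp ht).zero_mul_isBoundedUnder_le
      (isBoundedUnder_of ⟨1, hx⟩)
  have htends := ((continuous_geodesicFlow_oppositeHorocycleFlow u).tendsto (t₀, 0)).comp
    (hlim.prodMk_nhds (hvanish.comp hφ.tendsto_atTop))
  rw [oppositeHorocycleFlow_zero] at htends
  exact ⟨t₀, by linarith [ht₀.1],
    mem_closure_of_tendsto htends (Eventually.of_forall fun n => hmem (φ n))⟩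

theorem mainTheorem4 (Γ : Subgroup PSL(2, ℝ)) (hΓ : HyperbolicSurface.IsSurfaceGroup Γ)
    (u : HyperbolicSurface.UnitTangent Γ) (a b : ℝ) (ha : 0 < a) (hab : a ≤ b)
    (α : ℕ → HyperbolicSurface.ClosedGeodesic Γ) (hα : ∀ n, (α n).length ∈ Set.Icc a b)
    (t : ℕ → ℝ) (ht : Filter.Tendsto t Filter.atTop Filter.atTop)
    (hmeet : ∀ n, HyperbolicSurface.basePoint (HyperbolicSurface.geodesicFlow (t n) u)
      ∈ (α n).support) :
    ∃ t₀ : ℝ, 0 < t₀ ∧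
      HyperbolicSurface.geodesicFlow t₀ u ∈ closure (HyperbolicSurface.horocycleOrbit u) :=
  mainTheorem4_general Γ u a b ha α hα t ht hmeet
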